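/- Let $T$ be a Tychonoff (completely regular $T_0$) space, and let $C_p(T)$ be the set of all continuous functions $f:T\to\mathbb R$ with the topology inherited from the product $\mathbb R^T$. Call a topological space $X$ - *M-separable* if for every sequence $(D_n)_{n\in\omega}$ of dense subsets of $X$ there are finite sets $F_n\subseteq D_n$ ($n\in\omega$) such that $\bigcup_{n\in\omega}F_n$ is dense in $X$; - *S-separable* if for every sequence $(D_n)_{n\in\omega}$ of dense subsets of $X$ there are finite sets $F_n\subseteq D_n$ ($n\in\omega$) such that for every finite family $\{U_i : i<k\}$ of nonempty open subsets of $X$ there is an $n\in\omega$ with $U_i\cap F_n\neq\emptyset$ for all $i<k$; - *mS-separable* if the condition in the definition of S-separability holds for every decreasing sequence $D_0\supseteq D_1\supseteq\cdots$ of dense subsets of $X$. Then the following conditions are equivalent: 1. $C_p(T)$ is S-separable; 2. $C_p(T)$ is mS-separable; 3. $C_p(T)$ is M-separable. -/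

import Mathlib

/-- `X` is `M`-separable: for every sequence `D` of dense subsets one can pick finite sets
`F n ⊆ D n` whose union is dense. -/
def MSeparable (X : Type*) [TopologicalSpace X] : Prop :=
  ∀ D : ℕ → Set X, (∀ n, Dense (D n)) →
    ∃ F : ℕ → Set X, (∀ n, (F n).Finite ∧ F n ⊆ D n) ∧ Dense (⋃ n, F n)

/-- `F` is a witness of `S`-separability: every finite family of nonempty open sets is met,
all members at once, by a single `F n`. -/
def MeetsFiniteOpenFamilies {X : Type*} [TopologicalSpace X] (F : ℕ → Set X) : Prop :=
  ∀ (k : ℕ) (U : Fin k → Set X), (∀ i, IsOpen (U i) ∧ (U i).Nonempty) →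
    ∃ n, ∀ i, (U i ∩ F n).Nonempty

/-- `X` is `S`-separable: for every sequence `D` of dense subsets one can pick finite sets
`F n ⊆ D n` such that every finite family of nonempty open sets is met by a single `F n`. -/
def SSeparable (X : Type*) [TopologicalSpace X] : Prop :=
  ∀ D : ℕ → Set X, (∀ n, Dense (D n)) →
    ∃ F : ℕ → Set X, (∀ n, (F n).Finite ∧ F n ⊆ D n) ∧ MeetsFiniteOpenFamilies F

/-- `X` is `mS`-separable: the definition of `S`-separability, required only of decreasing
sequences `D 0 ⊇ D 1 ⊇ ⋯` of dense subsets. -/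
def MonoSSeparable (X : Type*) [TopologicalSpace X] : Prop :=
  ∀ D : ℕ → Set X, Antitone D → (∀ n, Dense (D n)) →
    ∃ F : ℕ → Set X, (∀ n, (F n).Finite ∧ F n ⊆ D n) ∧ MeetsFiniteOpenFamilies F

/-- `C_p(T)`: the continuous real functions on `T`, as a subtype of `T → ℝ`, so that instance
search gives it the subspace topology inherited from the product `ℝ^T`. -/
abbrev Cp (T : Type*) [TopologicalSpace T] : Type _ :=
  {f : T → ℝ // Continuous f}

open Set

/-! The bridge is `OmegaMenger T`. For an ω-cover, the functions equal to 1 off some member are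
dense in `Cp T`, and one that is near 0 on a finite set `A` has `A` inside that member; so
M-separability, even for decreasing sequences, yields `OmegaMenger T`. Conversely, fix a tuple `e`.
The sets on which a tuple from `D n` is close to `e` form an ω-cover, and a single member containing
`A` approximates all entries of `e` at once: this turns M into S. Separability of `Cp T` leaves only
countably many tuples and precisions to treat. -/

/-- `T` satisfies `S_fin(Ω, Ω)`: from every sequence of open `ω`-covers one can pick finite
subfamilies whose union is an `ω`-cover. -/
def OmegaMenger (T : Type*) [TopologicalSpace T] : Prop :=
  ∀ 𝒰 : ℕ → Set (Set T),
    (∀ n, (∀ U ∈ 𝒰 n, IsOpen U) ∧ ∀ A : Finset T, ∃ U ∈ 𝒰 n, (A : Set T) ⊆ U) →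
    ∃ 𝒱 : ℕ → Set (Set T), (∀ n, (𝒱 n).Finite ∧ 𝒱 n ⊆ 𝒰 n) ∧
      ∀ A : Finset T, ∃ n, ∃ U ∈ 𝒱 n, (A : Set T) ⊆ U

/-- The definition of `M`-separability, required only of decreasing sequences. -/
def MonoMSeparable (X : Type*) [TopologicalSpace X] : Prop :=
  ∀ D : ℕ → Set X, Antitone D → (∀ n, Dense (D n)) →
    ∃ F : ℕ → Set X, (∀ n, (F n).Finite ∧ F n ⊆ D n) ∧ Dense (⋃ n, F n)

section General

variable {X : Type*} [TopologicalSpace X]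

theorem MeetsFiniteOpenFamilies.dense_iUnion {F : ℕ → Set X} (hF : MeetsFiniteOpenFamilies F) :
    Dense (⋃ n, F n) := by
  rw [dense_iff_inter_open]
  intro U hU hne
  obtain ⟨n, hn⟩ := hF 1 (fun _ => U) (fun _ => ⟨hU, hne⟩)
  exact (hn 0).mono (inter_subset_inter_right _ (subset_iUnion F n))

theorem SSeparable.monoSSeparable (h : SSeparable X) : MonoSSeparable X :=
  fun D _ hD => h D hD

theorem SSeparable.mSeparable (h : SSeparable X) : MSeparable X := fun D hD =>
  let ⟨F, hF, hm⟩ := h D hD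
  ⟨F, hF, hm.dense_iUnion⟩

theorem MonoSSeparable.monoMSeparable (h : MonoSSeparable X) : MonoMSeparable X :=
  fun D hanti hD =>
    let ⟨F, hF, hm⟩ := h D hanti hD
    ⟨F, hF, hm.dense_iUnion⟩

theorem MSeparable.monoMSeparable (h : MSeparable X) : MonoMSeparable X :=
  fun D _ hD => h D hD

theorem MonoMSeparable.separableSpace (h : MonoMSeparable X) :
    TopologicalSpace.SeparableSpace X := by
  obtain ⟨F, hF, hd⟩ := h (fun _ => univ) antitone_const (fun _ => dense_univ)
  exact ⟨⋃ n, F n, countable_iUnion fun n => (hF n).1.countable, hd⟩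

end General

section FunctionSpace

variable {T : Type*} [TopologicalSpace T]

namespace Cp

instance : Nonempty (Cp T) := ⟨⟨fun _ => 0, continuous_const⟩⟩

theorem isOpen_setOf_forall_abs_sub_lt (A : Finset T) (g : T → ℝ) (ε : ℝ) :
    IsOpen {f : Cp T | ∀ t ∈ A, |f.1 t - g t| < ε} := by
  have : {f : Cp T | ∀ t ∈ A, |f.1 t - g t| < ε} = ⋂ t ∈ A, {f : Cp T | |f.1 t - g t| < ε} := by
    ext f
    simp
  rw [this]
  refine isOpen_biInter_finset fun t _ => isOpen_lt ?_ continuous_const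
  exact (((continuous_apply t).comp continuous_subtype_val).sub continuous_const).abs

theorem exists_forall_abs_sub_lt_imp_mem {U : Set (Cp T)} (hU : IsOpen U) {e : Cp T}
    (he : e ∈ U) :
    ∃ A : Finset T, ∃ ε > 0, ∀ f : Cp T, (∀ t ∈ A, |f.1 t - e.1 t| < ε) → f ∈ U := by
  obtain ⟨V, hV, rfl⟩ := isOpen_induced_iff.1 hU
  obtain ⟨A, u, hu, hsub⟩ := isOpen_pi_iff.1 hV e.1 he
  have hball : ∀ t : A, ∃ ε > 0, Metric.ball (e.1 t) ε ⊆ u t := fun t =>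
    Metric.isOpen_iff.1 (hu t t.2).1 _ (hu t t.2).2
  choose r hr hru using hball
  obtain ⟨ε, hε, hεr⟩ : ∃ ε > 0, ∀ t : A, ε ≤ r t := by
    rcases isEmpty_or_nonempty A with _ | _
    · exact ⟨1, one_pos, fun t => isEmptyElim t⟩
    · obtain ⟨t₀, ht₀⟩ := Finite.exists_min r
      exact ⟨r t₀, hr t₀, ht₀⟩
  refine ⟨A, ε, hε, fun f hf => hsub fun t ht => hru ⟨t, ht⟩ ?_⟩
  rw [Metric.mem_ball, Real.dist_eq]
  exact (hf t ht).trans_le (hεr ⟨t, ht⟩)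

/-- In a Tychonoff space, prescribed values on a finite subset of an open set `W` are taken by a
continuous function that is constantly `1` off `W`. -/
theorem exists_eq_on_finset_eq_one_off [T35Space T] (A : Finset T) {W : Set T} (hW : IsOpen W)
    (hAW : (A : Set T) ⊆ W) (g : T → ℝ) :
    ∃ f : Cp T, (∀ t ∈ A, f.1 t = g t) ∧ ∀ t ∉ W, f.1 t = 1 := by
  classical
  have hbump : ∀ x : T, ∃ h : T → ℝ, Continuous h ∧ (x ∈ A → h x = 1) ∧
      (∀ t ∈ A, t ≠ x → h t = 0) ∧ ∀ t ∉ W, h t = 0 := by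
    intro x
    by_cases hx : x ∈ A
    · have hcl : IsClosed (Wᶜ ∪ (A.erase x : Set T)) :=
        hW.isClosed_compl.union (A.erase x).finite_toSet.isClosed
      obtain ⟨f, hf, hfx, hfK⟩ := CompletelyRegularSpace.completely_regular x _ hcl
        (by simp [hAW hx])
      refine ⟨fun t => 1 - (f t : ℝ), by fun_prop, fun _ => by simp [hfx], ?_, ?_⟩
      · intro t ht htx
        have := hfK (Or.inr (by simp [ht, htx]) : t ∈ Wᶜ ∪ (A.erase x : Set T))
        simp [this]
      · intro t ht
        have := hfK (Or.inl ht : t ∈ Wᶜ ∪ (A.erase x : Set T))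
        simp [this]
    · exact ⟨fun _ => 0, continuous_const, fun h => absurd h hx, fun _ _ _ => rfl, fun _ _ => rfl⟩
  choose h hc h1 h0 hoff using hbump
  -- Each summand corrects the constant 1 at one point of `A` and vanishes at the other points of
  -- `A` and off `W`.
  refine ⟨⟨fun t => 1 + ∑ x ∈ A, (g x - 1) * h x t, ?_⟩, ?_, ?_⟩
  · exact continuous_const.add (continuous_finsetSum _ fun x _ => continuous_const.mul (hc x))
  · intro t ht
    have : ∑ x ∈ A, (g x - 1) * h x t = (g t - 1) * h t t :=
      Finset.sum_eq_single_of_mem t ht fun x _ hxt => by rw [h0 x t ht hxt.symm, mul_zero]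
    simp [this, h1 t ht]
  · intro t ht
    have : ∑ x ∈ A, (g x - 1) * h x t = 0 :=
      Finset.sum_eq_zero fun x _ => by rw [hoff x t ht, mul_zero]
    simp [this]

end Cp

theorem MonoMSeparable.omegaMenger [T35Space T] (h : MonoMSeparable (Cp T)) : OmegaMenger T := by
  intro 𝒰 h𝒰
  -- Imposing the condition for all `i ≤ n` makes `D` decreasing; density survives because finitely
  -- many members containing `A` have an open intersection.
  let D : ℕ → Set (Cp T) := fun n => {f | ∀ i ≤ n, ∃ U ∈ 𝒰 i, ∀ t ∉ U, f.1 t = 1}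
  have hanti : Antitone D := fun m n hmn f hf i hi => hf i (hi.trans hmn)
  have hdense : ∀ n, Dense (D n) := by
    intro n
    rw [dense_iff_inter_open]
    rintro O hO ⟨e, he⟩
    obtain ⟨A, ε, hε, hA⟩ := Cp.exists_forall_abs_sub_lt_imp_mem hO he
    choose U hU hAU using fun i => (h𝒰 i).2 A
    have hW : IsOpen (⋂ i ∈ Finset.range (n + 1), U i) :=
      isOpen_biInter_finset fun i _ => (h𝒰 i).1 _ (hU i)
    obtain ⟨f, hfA, hfW⟩ := Cp.exists_eq_on_finset_eq_one_off A hW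
      (subset_iInter₂ fun i _ => hAU i) e.1
    refine ⟨f, hA f fun t ht => by simpa [hfA t ht] using hε, fun i hi => ⟨U i, hU i, ?_⟩⟩
    intro t ht
    refine hfW t fun htW => ht ?_
    exact mem_iInter₂.1 htW i (Finset.mem_range.2 (Nat.lt_succ_of_le hi))
  obtain ⟨F, hF, hd⟩ := h D hanti hdense
  have hsel : ∀ n, ∀ f : Cp T, ∃ U, f ∈ F n → U ∈ 𝒰 n ∧ ∀ t ∉ U, f.1 t = 1 := by
    intro n f
    by_cases hf : f ∈ F n
    · obtain ⟨U, hU⟩ := (hF n).2 hf n le_rfl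
      exact ⟨U, fun _ => hU⟩
    · exact ⟨∅, fun h => absurd h hf⟩
  choose U hU using hsel
  refine ⟨fun n => U n '' F n, fun n => ⟨(hF n).1.image _, ?_⟩, fun A => ?_⟩
  · rintro _ ⟨f, hf, rfl⟩
    exact (hU n f hf).1
  · obtain ⟨f, hfA, hf⟩ := hd.inter_open_nonempty _
      (Cp.isOpen_setOf_forall_abs_sub_lt A (fun _ => 0) 1)
      ⟨⟨fun _ => 0, continuous_const⟩, fun t _ => by simp⟩
    obtain ⟨n, hn⟩ := mem_iUnion.1 hf
    refine ⟨n, U n f, mem_image_of_mem _ hn, fun t ht => ?_⟩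
    by_contra htU
    have := hfA t ht
    simp [(hU n f hn).2 t htU] at this

/-- Under `S_fin(Ω, Ω)`, finite subsets of dense sets of functions can be chosen so that one of
them approximates a given finite tuple on any given finite set. -/
theorem OmegaMenger.exists_finite_approx (h : OmegaMenger T) {D : ℕ → Set (Cp T)}
    (hD : ∀ n, Dense (D n)) {k : ℕ} (e : Fin k → Cp T) {ε : ℝ} (hε : 0 < ε) :
    ∃ F : ℕ → Set (Cp T), (∀ n, (F n).Finite ∧ F n ⊆ D n) ∧
      ∀ A : Finset T, ∃ n, ∀ i, ∃ f ∈ F n, ∀ t ∈ A, |f.1 t - (e i).1 t| < ε := by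
  let V : (Fin k → Cp T) → Set T := fun f => {t | ∀ i, |(f i).1 t - (e i).1 t| < ε}
  obtain ⟨𝒱, h𝒱, hcov⟩ := h (fun n => V '' {f | ∀ i, f i ∈ D n}) (fun n => by
    constructor
    · rintro _ ⟨f, -, rfl⟩
      have : V f = ⋂ i, {t | |(f i).1 t - (e i).1 t| < ε} := by
        ext t
        simp [V]
      rw [this]
      exact isOpen_iInter_of_finite fun i =>
        isOpen_lt ((f i).2.sub (e i).2).abs continuous_const
    · intro A
      have happrox : ∀ i, ∃ f ∈ D n, ∀ t ∈ A, |f.1 t - (e i).1 t| < ε := fun i =>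
        let ⟨f, hfA, hf⟩ := (hD n).inter_open_nonempty _
          (Cp.isOpen_setOf_forall_abs_sub_lt A (e i).1 ε) ⟨e i, fun t _ => by simpa using hε⟩
        ⟨f, hf, hfA⟩
      choose f hf hfA using happrox
      exact ⟨V f, mem_image_of_mem _ hf, fun t ht i => hfA i t ht⟩)
  -- The selection yields sets of points; each finite subfamily is lifted to finitely many tuples
  -- defining it.
  have hlift : ∀ n, ∃ s ⊆ {f : Fin k → Cp T | ∀ i, f i ∈ D n}, s.Finite ∧ V '' s = 𝒱 n :=
    fun n => (exists_subset_image_finite_and (p := fun s => s = 𝒱 n)).1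
      ⟨𝒱 n, (h𝒱 n).2, (h𝒱 n).1, rfl⟩
  choose s hsD hsfin hsV using hlift
  refine ⟨fun n => ⋃ i, (fun f => f i) '' s n, fun n => ⟨?_, ?_⟩, fun A => ?_⟩
  · exact finite_iUnion fun i => (hsfin n).image _
  · refine iUnion_subset fun i => ?_
    rintro _ ⟨f, hf, rfl⟩
    exact hsD n hf i
  · obtain ⟨n, U, hU, hAU⟩ := hcov A
    rw [← hsV n] at hU
    obtain ⟨f, hf, rfl⟩ := hU
    exact ⟨n, fun i => ⟨f i, mem_iUnion.2 ⟨i, mem_image_of_mem _ hf⟩, fun t ht => hAU ht i⟩⟩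

theorem OmegaMenger.sSeparable [TopologicalSpace.SeparableSpace (Cp T)] (h : OmegaMenger T) :
    SSeparable (Cp T) := by
  intro D hD
  let e := TopologicalSpace.denseSeq (Cp T)
  -- Pairing splits `D` into disjointly indexed subsequences, one for each precision `p.1` and tuple
  -- `p.2` of indices into the dense sequence.
  have : ∀ p : ℕ × List ℕ, ∃ F : ℕ → Set (Cp T),
      (∀ n, (F n).Finite ∧ F n ⊆ D (Nat.pair (Encodable.encode p) n)) ∧
      ∀ A : Finset T, ∃ n, ∀ i, ∃ f ∈ F n, ∀ t ∈ A,
        |f.1 t - (e (p.2.get i)).1 t| < 1 / ((p.1 : ℝ) + 1) := fun p =>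
    h.exists_finite_approx (fun n => hD _) (fun i => e (p.2.get i)) Nat.one_div_pos_of_nat
  choose F hF happ using this
  -- At most one `p` has the required code, so each set is some `F p _` or empty.
  refine ⟨fun n => {f | ∃ p : ℕ × List ℕ, Encodable.encode p = n.unpair.1 ∧ f ∈ F p n.unpair.2},
    fun n => ⟨?_, ?_⟩, ?_⟩
  · by_cases hp : ∃ p : ℕ × List ℕ, Encodable.encode p = n.unpair.1
    · obtain ⟨p, hp⟩ := hp
      refine (hF p n.unpair.2).1.subset ?_
      rintro f ⟨q, hq, hf⟩
      rwa [Encodable.encode_injective (hq.trans hp.symm)] at hf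
    · convert finite_empty
      exact eq_empty_of_forall_notMem fun f ⟨p, hq, _⟩ => hp ⟨p, hq⟩
  · rintro f ⟨p, hp, hf⟩
    have := (hF p n.unpair.2).2 hf
    rwa [hp, Nat.pair_unpair] at this
  · intro k U hU
    have hmem : ∀ i, ∃ j, e j ∈ U i := fun i =>
      let ⟨_, hx, j, hj⟩ := (TopologicalSpace.denseRange_denseSeq (Cp T)).inter_open_nonempty
        _ (hU i).1 (hU i).2
      ⟨j, by rwa [← hj] at hx⟩
    choose j hj using hmem
    choose A ε hε hA using fun i => Cp.exists_forall_abs_sub_lt_imp_mem (hU i).1 (hj i)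
    obtain ⟨m, hm⟩ : ∃ m : ℕ, ∀ i, 1 / ((m : ℝ) + 1) < ε i := by
      rcases isEmpty_or_nonempty (Fin k) with _ | _
      · exact ⟨0, fun i => isEmptyElim i⟩
      · obtain ⟨i₀, hi₀⟩ := Finite.exists_min ε
        obtain ⟨m, hm⟩ := exists_nat_one_div_lt (hε i₀)
        exact ⟨m, fun i => hm.trans_le (hi₀ i)⟩
    classical
    obtain ⟨n, hn⟩ := happ (m, List.ofFn j) (Finset.univ.biUnion A)
    refine ⟨Nat.pair (Encodable.encode (m, List.ofFn j)) n, fun i => ?_⟩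
    obtain ⟨f, hf, hfA⟩ := hn (Fin.cast (List.length_ofFn).symm i)
    refine ⟨f, hA i f fun t ht => ?_, (m, List.ofFn j), by simp, by simpa using hf⟩
    have := hfA t (Finset.mem_biUnion.2 ⟨i, Finset.mem_univ i, ht⟩)
    simp only [List.get_ofFn, Fin.cast_cast, Fin.cast_eq_self] at this
    exact this.trans (hm i)

theorem MonoMSeparable.sSeparable [T35Space T] (h : MonoMSeparable (Cp T)) :
    SSeparable (Cp T) :=
  have := h.separableSpace
  h.omegaMenger.sSeparable

end FunctionSpace

theorem theorem3 (T : Type*) [TopologicalSpace T] [T35Space T] :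
    List.TFAE [SSeparable (Cp T), MonoSSeparable (Cp T), MSeparable (Cp T)] := by
  tfae_have 1 → 2 := SSeparable.monoSSeparable
  tfae_have 2 → 1 := fun h => h.monoMSeparable.sSeparable
  tfae_have 1 → 3 := SSeparable.mSeparable
  tfae_have 3 → 1 := fun h => h.monoMSeparable.sSeparable
  tfae_finish
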